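/- Let $A$ be a (not necessarily unital) $C^*$-algebra and $E$ a Hilbert $C^*$-module over $A$. Write $L(E)$ for the bounded adjointable operators on $E$, and $K(E)\subseteq L(E)$ for the closed linear span of the operators $\theta_{x,y}$, $x,y\in E$, which send $z\in E$ to the product of $x$ with the coefficient $\langle y,z\rangle\in A$. A closed, densely defined, $A$-linear operator $t: D(t)\subseteq E\to E$ with densely defined adjoint $t^*$ is called \emph{regular} if $1+t^*t$ has dense range; $R(E)$ denotes the set of regular operators on $E$. A regular operator $t$ is called \emph{Fredholm} if there are $G,H\in L(E)$ such that $Gt$ and $tH$ are closable, their closures belong to $L(E)$, and $\overline{Gt}-1\in K(E)$, $\overline{tH}-1\in K(E)$. For a regular operator $t$ put $R_t=(1+t^*t)^{-1}$, a bounded operator on $E$, and for $t,s\in R(E)$ define $$d(t,s)=\max\{\|R_t-R_s\|,\ \|R_{t^*}-R_{s^*}\|,\ \|tR_t-sR_s\|\},\qquad g(t,s)=\|P_{G(t)}-P_{G(s)}\|,$$ where $P_{G(t)}$ is the orthogonal projection of $E\oplus E$ onto the graph $G(t)=\{(x,tx): x\in D(t)\}$ (so $g$ is the gap metric). Then for every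 regular Fredholm operator $t$ on $E$ there is $r>0$ such that every regular operator $s$ on $E$ with $d(s,t)\le r$ is Fredholm. Moreover, the set of regular Fredholm operators on $E$ is open in $R(E)$ with respect to the gap metric $g$. -/

import Mathlib

open scoped InnerProductSpace WithCStarModule

noncomputable section

namespace HilbertModule

/-! Partially defined linear operators. -/

section PMap

variable {E : Type*} [NormedAddCommGroup E] [NormedSpace ℂ E]

/-- The composition `g f` of unbounded operators, with its natural domain
`{x ∈ D(f) | f x ∈ D(g)}`. -/
def pcomp (g f : E →ₗ.[ℂ] E) : E →ₗ.[ℂ] E :=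
  g.comp (f.domRestrict ((g.domain.comap f.toFun).map f.domain.subtype)) (by
    rintro ⟨x, hx, hxf⟩
    obtain ⟨y, hy, rfl⟩ := Submodule.mem_map.1 hx
    have h : f.domRestrict _ ⟨(y : E), hx, hxf⟩ = f y := LinearPMap.domRestrict_apply rfl
    exact h ▸ hy)

theorem mem_graph_pcomp (g f : E →ₗ.[ℂ] E) (x z : E) :
    (x, z) ∈ (pcomp g f).graph ↔ ∃ y, (x, y) ∈ f.graph ∧ (y, z) ∈ g.graph := by
  simp only [LinearPMap.mem_graph_iff]
  constructor
  · rintro ⟨⟨x', hx, hxf⟩, rfl, hz⟩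
    obtain ⟨y, hy, rfl⟩ := Submodule.mem_map.1 hx
    exact ⟨f y, ⟨y, rfl, rfl⟩, ⟨⟨f y, hy⟩, rfl, hz⟩⟩
  · rintro ⟨y, ⟨x', rfl, rfl⟩, ⟨⟨y', hy'⟩, hy, rfl⟩⟩
    subst hy
    exact ⟨⟨x', Submodule.mem_map.2 ⟨x', hy', rfl⟩, x'.2⟩, rfl, rfl⟩

/-- A bounded operator regarded as an unbounded operator with domain `E`. -/
def ofBounded (T : E →L[ℂ] E) : E →ₗ.[ℂ] E :=
  (T : E →ₗ[ℂ] E).toPMap ⊤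

open Classical in
/-- If `f` is everywhere defined and bounded, `f` as a bounded operator (and `0` otherwise). -/
def toBounded (f : E →ₗ.[ℂ] E) : E →L[ℂ] E :=
  if h : ∃ T : E →L[ℂ] E, ofBounded T = f then h.choose else 0

theorem toBounded_ofBounded (T : E →L[ℂ] E) : toBounded (ofBounded T) = T := by
  have h : ∃ S : E →L[ℂ] E, ofBounded S = ofBounded T := ⟨T, rfl⟩
  rw [toBounded, dif_pos h]
  ext x
  have h1 : (x, h.choose x) ∈ (ofBounded h.choose).graph :=
    LinearPMap.mem_graph (ofBounded h.choose) ⟨x, trivial⟩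
  rw [h.choose_spec] at h1
  exact LinearPMap.mem_graph_snd_inj (ofBounded T) h1
    (LinearPMap.mem_graph (ofBounded T) ⟨x, trivial⟩) rfl

end PMap

section Module

variable (A : Type*) {E : Type*} [NonUnitalCStarAlgebra A] [PartialOrder A] [StarOrderedRing A]
  [NormedAddCommGroup E] [NormedSpace ℂ E] [SMul A E] [CStarModule A E]

/-! Bounded adjointable operators and compact operators. -/

/-- `T ∈ L(E)`: the bounded operator `T` is adjointable. -/
def IsAdjointable (T : E →L[ℂ] E) : Prop :=
  ∃ S : E →L[ℂ] E, ∀ x y : E, ⟪T x, y⟫_A = ⟪x, S y⟫_A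

variable (E) in
/-- `K(E)`: the closed linear span of the elementary operators `z ↦ ⟨y, z⟩ x`. -/
def compacts : Submodule ℂ (E →L[ℂ] E) :=
  (Submodule.span ℂ {T : E →L[ℂ] E | ∃ x y : E, ∀ z, T z = ⟪y, z⟫_A • x}).topologicalClosure

/-! Regular operators. -/

/-- The set of pairs `(y, z)` with `⟨t x, y⟩ = ⟨x, z⟩` for all `x ∈ D(t)`. -/
def adjointGraph (t : E →ₗ.[ℂ] E) : Submodule ℂ (E × E) where
  carrier := {p | ∀ x : t.domain, ⟪t x, p.1⟫_A = ⟪(x : E), p.2⟫_A}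
  add_mem' := by
    intro p q hp hq x
    simp [hp x, hq x]
  zero_mem' := by
    intro x
    simp
  smul_mem' := by
    intro c p hp x
    simp [hp x]

/-- The adjoint `t*` of a densely defined operator `t`: `y ∈ D(t*)` with `t* y = z` iff
`⟨t x, y⟩ = ⟨x, z⟩` for all `x ∈ D(t)`. -/
def adjoint (t : E →ₗ.[ℂ] E) : E →ₗ.[ℂ] E :=
  (adjointGraph A t).toLinearPMap

theorem graph_adjoint (t : E →ₗ.[ℂ] E) (ht : Dense (t.domain : Set E)) :
    (adjoint A t).graph = adjointGraph A t := by
  refine Submodule.toLinearPMap_graph_eq _ ?_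
  rintro ⟨y, z⟩ h hy
  obtain rfl : y = 0 := hy
  have h0 : ∀ x ∈ (t.domain : Set E), ⟪x, z⟫_A = 0 := fun x hx => by
    simpa using (h ⟨x, hx⟩).symm
  have hc : Continuous fun x : E => ⟪x, z⟫_A :=
    CStarModule.continuous_inner.comp (continuous_id.prodMk continuous_const)
  have h1 := hc.ext_on ht continuous_const h0
  exact (CStarModule.inner_self (A := A)).1 (congrFun h1 z)

/-- The operator `1 + t* t` with domain `D(t* t)`. -/
def oneAddAdjointMul (t : E →ₗ.[ℂ] E) : E →ₗ.[ℂ] E :=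
  (LinearMap.id : E →ₗ[ℂ] E) +ᵥ pcomp (adjoint A t) t

/-- Regular operators: closed densely defined `A`-linear operators, defined on an `A`-submodule,
with densely defined adjoint, and such that `1 + t* t` has dense range. -/
structure IsRegular (t : E →ₗ.[ℂ] E) : Prop where
  smul_mem : ∀ (a : A) (x : E), x ∈ t.domain → a • x ∈ t.domain
  map_smul : ∀ (a : A) (x y : t.domain), (y : E) = a • (x : E) → t y = a • t x
  closed : t.IsClosed
  dense_domain : Dense (t.domain : Set E)
  dense_adjoint_domain : Dense ((adjoint A t).domain : Set E)
  dense_range : Dense (Set.range (oneAddAdjointMul A t))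

/-! Fredholm operators. -/

/-- The closable operator `f` has closure in `L(E)`, congruent to `1` modulo `K(E)`. -/
def ClosureEqOneModCompacts (f : E →ₗ.[ℂ] E) : Prop :=
  f.IsClosable ∧ ∃ T : E →L[ℂ] E, IsAdjointable A T ∧ f.closure = ofBounded T ∧
    T - ContinuousLinearMap.id ℂ E ∈ compacts A E

def IsPseudoLeftInverse (G : E →L[ℂ] E) (t : E →ₗ.[ℂ] E) : Prop :=
  IsAdjointable A G ∧ ClosureEqOneModCompacts A (pcomp (ofBounded G) t)

def IsPseudoRightInverse (G : E →L[ℂ] E) (t : E →ₗ.[ℂ] E) : Prop :=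
  IsAdjointable A G ∧ ClosureEqOneModCompacts A (pcomp t (ofBounded G))

/-- The Fredholm property of a regular operator `t`. -/
def IsFredholm (t : E →ₗ.[ℂ] E) : Prop :=
  (∃ G, IsPseudoLeftInverse A G t) ∧ (∃ G, IsPseudoRightInverse A G t)

/-! The metric `d`. -/

/-- `R_t = (1 + t* t)⁻¹`, an everywhere defined bounded operator when `t` is regular. -/
def resolventSq (t : E →ₗ.[ℂ] E) : E →L[ℂ] E :=
  toBounded (oneAddAdjointMul A t).inverse

/-- `t R_t`, an everywhere defined bounded operator when `t` is regular. -/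
def mulResolventSq (t : E →ₗ.[ℂ] E) : E →L[ℂ] E :=
  toBounded (pcomp t (ofBounded (resolventSq A t)))

/-- `d(t, s) = sup {‖R_t - R_s‖, ‖R_{t*} - R_{s*}‖, ‖t R_t - s R_s‖}`. -/
def graphDist (t s : E →ₗ.[ℂ] E) : ℝ :=
  max ‖resolventSq A t - resolventSq A s‖
    (max ‖resolventSq A (adjoint A t) - resolventSq A (adjoint A s)‖
      ‖mulResolventSq A t - mulResolventSq A s‖)

/-! The gap metric on the space of regular operators. -/

/-- `P` is the orthogonal projection of the Hilbert module `E ⊕ E` onto the graph of `t`. -/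
def IsGraphProjection (t : E →ₗ.[ℂ] E) (P : C⋆ᵐᵒᵈ(A, E × E) →L[ℂ] C⋆ᵐᵒᵈ(A, E × E)) : Prop :=
  ∀ v, WithCStarModule.equiv A (E × E) (P v) ∈ t.graph ∧
    ∀ w, WithCStarModule.equiv A (E × E) w ∈ t.graph → ⟪v - P v, w⟫_A = 0

open Classical in
/-- The orthogonal projection onto the graph of `t`; it exists when `t` is regular. -/
def graphProjection (t : E →ₗ.[ℂ] E) : C⋆ᵐᵒᵈ(A, E × E) →L[ℂ] C⋆ᵐᵒᵈ(A, E × E) :=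
  if h : ∃ P, IsGraphProjection A t P then h.choose else 0

variable (E) in
/-- `R(E)`: the space of regular operators on `E`. -/
structure RegularOperator where
  op : E →ₗ.[ℂ] E
  regular : IsRegular A op

/-- The gap metric `g(t, s) = ‖P_{G(t)} - P_{G(s)}‖` on `R(E)`. -/
instance : PseudoMetricSpace (RegularOperator A E) :=
  PseudoMetricSpace.induced (fun t => graphProjection A t.op) inferInstance

theorem dist_eq (t s : RegularOperator A E) :
    dist t s = ‖graphProjection A t.op - graphProjection A s.op‖ :=
  dist_eq_norm (graphProjection A t.op) (graphProjection A s.op)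

end Module

end HilbertModule

end

/-! For regular `t` the module `E ⊕ E` is the orthogonal sum of `G(t)` and `{(z, -y) : (y, z) ∈
G(t*)}`. Write the projection onto `G(t)` as a matrix with rows `(a, b)` and `(c, d)`. Then `a =
R_t`, `c = t R_t`, `d = 1 - R_{t*}` and `b = c*`, so both metrics control the same bounded entries.

Fredholmness can be read off these entries: a left inverse modulo `K(E)` exists iff `V(1 - a) + Wc ∈
1 + K(E)` for some adjointable `V, W`, and a right inverse iff `cV + dW ∈ 1 + K(E)` for some
adjointable `V, W` (`exists_isPseudoLeftInverse_iff`, `exists_isPseudoRightInverse_iff`). With `V,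
W` fixed, a small change of `a, c, d` leaves these operators invertible modulo `K(E)` by the Neumann
series (`exists_inverse_mod_compacts`), and the inverse is absorbed into `V` and `W`. -/

noncomputable section

namespace HilbertModule

/-! Adjointable operators and compact operators. -/

section Bounded

set_option linter.unusedSectionVars false

variable {A E : Type*} [NonUnitalCStarAlgebra A] [PartialOrder A] [StarOrderedRing A]
  [NormedAddCommGroup E] [NormedSpace ℂ E] [SMul A E] [CStarModule A E]

theorem ext_inner_left {x y : E} (h : ∀ z : E, ⟪z, x⟫_A = ⟪z, y⟫_A) : x = y := by
  rw [← sub_eq_zero, ← CStarModule.inner_self (A := A), CStarModule.inner_sub_right, h, sub_self]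

theorem inner_eq_swap {x y z w : E} (h : ⟪x, y⟫_A = ⟪z, w⟫_A) : ⟪y, x⟫_A = ⟪w, z⟫_A := by
  rw [← CStarModule.star_inner x y, h, CStarModule.star_inner]

theorem isAdjointable_one : IsAdjointable A (1 : E →L[ℂ] E) := ⟨1, fun _ _ => rfl⟩

theorem IsAdjointable.mul {S T : E →L[ℂ] E} (hS : IsAdjointable A S) (hT : IsAdjointable A T) :
    IsAdjointable A (S * T) := by
  obtain ⟨S', hS⟩ := hS
  obtain ⟨T', hT⟩ := hT
  exact ⟨T' * S', fun x y => by simp [hS, hT]⟩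

theorem IsAdjointable.add {S T : E →L[ℂ] E} (hS : IsAdjointable A S) (hT : IsAdjointable A T) :
    IsAdjointable A (S + T) := by
  obtain ⟨S', hS⟩ := hS
  obtain ⟨T', hT⟩ := hT
  exact ⟨S' + T', fun x y => by simp [hS, hT]⟩

theorem IsAdjointable.sub {S T : E →L[ℂ] E} (hS : IsAdjointable A S) (hT : IsAdjointable A T) :
    IsAdjointable A (S - T) := by
  obtain ⟨S', hS⟩ := hS
  obtain ⟨T', hT⟩ := hT
  exact ⟨S' - T', fun x y => by simp [hS, hT]⟩

theorem IsAdjointable.map_smul {T : E →L[ℂ] E} (hT : IsAdjointable A T) (a : A) (x : E) :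
    T (a • x) = a • T x := by
  obtain ⟨S, hS⟩ := hT
  refine ext_inner_left (A := A) fun z => ?_
  rw [inner_eq_swap (hS (a • x) z), CStarModule.inner_op_smul_right,
    CStarModule.inner_op_smul_right, inner_eq_swap (hS x z)]

/-- The norm of an adjoint is at most the norm of the operator. -/
theorem norm_adjoint_le {S T : E →L[ℂ] E} (h : ∀ x y : E, ⟪T x, y⟫_A = ⟪x, S y⟫_A) :
    ‖S‖ ≤ ‖T‖ := by
  refine S.opNorm_le_bound (norm_nonneg _) fun y => ?_
  rcases eq_or_ne (S y) 0 with h0 | h0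
  · rw [h0, norm_zero]; positivity
  have hpos : 0 < ‖S y‖ := norm_pos_iff.2 h0
  have h1 : ‖S y‖ * ‖S y‖ ≤ ‖T‖ * ‖y‖ * ‖S y‖ :=
    calc ‖S y‖ * ‖S y‖ = ‖⟪T (S y), y⟫_A‖ := by
          rw [h, ← CStarModule.norm_sq_eq A, pow_two]
      _ ≤ ‖T (S y)‖ * ‖y‖ := CStarModule.norm_inner_le E
      _ ≤ (‖T‖ * ‖S y‖) * ‖y‖ := by gcongr; exact T.le_opNorm _
      _ = ‖T‖ * ‖y‖ * ‖S y‖ := by ring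
  exact le_of_mul_le_mul_right h1 hpos

/-- Neumann series: `1 - T` has an adjointable inverse if `T` is adjointable and `‖T‖ < 1`. -/
theorem IsAdjointable.exists_inverse_one_sub [CompleteSpace E] {T : E →L[ℂ] E}
    (hT : IsAdjointable A T) (h : ‖T‖ < 1) :
    ∃ U : E →L[ℂ] E, IsAdjointable A U ∧ (1 - T) * U = 1 ∧ U * (1 - T) = 1 := by
  obtain ⟨S, hS⟩ := hT
  let u := Units.oneSub T h
  -- The inverse of `1 - S` will be the adjoint of the inverse of `1 - T`; it exists because `‖S‖ ≤
  -- ‖T‖ < 1`.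
  let v := Units.oneSub S ((norm_adjoint_le hS).trans_lt h)
  have hu : (1 - T) * (↑u⁻¹ : E →L[ℂ] E) = 1 := u.mul_inv
  have hv : (1 - S) * (↑v⁻¹ : E →L[ℂ] E) = 1 := v.mul_inv
  refine ⟨↑u⁻¹, ⟨↑v⁻¹, fun x y => ?_⟩, hu, u.inv_mul⟩
  have hx := congrArg (fun f : E →L[ℂ] E => f x) hu
  have hy := congrArg (fun f : E →L[ℂ] E => f y) hv
  simp only [mul_apply_eq_comp, sub_apply, one_apply_eq_self] at hx hy
  conv_lhs => rw [← hy]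
  conv_rhs => rw [← hx]
  simp [hS]

/-- On generators `θ_{x,y} T = θ_{x,T* y}`; linearity and continuity of multiplication do the rest.
-/
theorem compacts_mul_mem {K T : E →L[ℂ] E} (hK : K ∈ compacts A E) (hT : IsAdjointable A T) :
    K * T ∈ compacts A E := by
  obtain ⟨S, hS⟩ := hT
  let φ : (E →L[ℂ] E) →L[ℂ] (E →L[ℂ] E) := (ContinuousLinearMap.mul ℂ (E →L[ℂ] E)).flip T
  refine map_mem_closure (f := φ) φ.continuous hK fun k hk => ?_
  refine Submodule.span_induction (p := fun k _ => φ k ∈ Submodule.span ℂ _) ?_ ?_ ?_ ?_ hk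
  · rintro k ⟨x, y, hk⟩
    refine Submodule.subset_span ⟨x, S y, fun z => ?_⟩
    change k (T z) = _
    rw [hk, inner_eq_swap (hS z y)]
  · simp
  · intro a b _ _ ha hb
    rw [map_add]; exact Submodule.add_mem _ ha hb
  · intro c a _ ha
    rw [map_smul]; exact Submodule.smul_mem _ c ha

theorem mul_compacts_mem {K T : E →L[ℂ] E} (hK : K ∈ compacts A E) (hT : IsAdjointable A T) :
    T * K ∈ compacts A E := by
  let φ : (E →L[ℂ] E) →L[ℂ] (E →L[ℂ] E) := ContinuousLinearMap.mul ℂ (E →L[ℂ] E) T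
  refine map_mem_closure (f := φ) φ.continuous hK fun k hk => ?_
  refine Submodule.span_induction (p := fun k _ => φ k ∈ Submodule.span ℂ _) ?_ ?_ ?_ ?_ hk
  · rintro k ⟨x, y, hk⟩
    refine Submodule.subset_span ⟨T x, y, fun z => ?_⟩
    change T (k z) = _
    rw [hk, hT.map_smul]
  · simp
  · intro a b _ _ ha hb
    rw [map_add]; exact Submodule.add_mem _ ha hb
  · intro c a _ ha
    rw [map_smul]; exact Submodule.smul_mem _ c ha

/-- An adjointable operator at distance less than `1` from `1 + K(E)` is invertible
modulo `K(E)`. -/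
theorem exists_inverse_mod_compacts [CompleteSpace E] {B C : E →L[ℂ] E}
    (hB : IsAdjointable A B) (hC : IsAdjointable A C) (hBK : B - 1 ∈ compacts A E)
    (h : ‖C - B‖ < 1) :
    ∃ U : E →L[ℂ] E, IsAdjointable A U ∧ C * U - 1 ∈ compacts A E ∧
      U * C - 1 ∈ compacts A E := by
  -- `1 - (B - C) = C - (B - 1)`, so `C` is an invertible operator plus a compact one.
  obtain ⟨U, hU, h1, h2⟩ := (hB.sub hC).exists_inverse_one_sub (by rwa [norm_sub_rev])
  have e1 : C * U - 1 = (B - 1) * U := by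
    nth_rewrite 1 [← h1]; noncomm_ring
  have e2 : U * C - 1 = U * (B - 1) := by
    nth_rewrite 1 [← h2]; noncomm_ring
  exact ⟨U, hU, e1 ▸ compacts_mul_mem hBK hU, e2 ▸ mul_compacts_mem hBK hU⟩

end Bounded

/-! Orthogonal decompositions with respect to a closed subspace. -/

section Decomposition

variable (A : Type*) {F : Type*} [NonUnitalCStarAlgebra A] [PartialOrder A] [StarOrderedRing A]
  [NormedAddCommGroup F] [NormedSpace ℂ F] [SMul A F] [CStarModule A F]

/-- The algebraic sum of `M` and its orthogonal complement. -/
def orthogonalSum (M : Submodule ℂ F) : Submodule ℂ F where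
  carrier := {v | ∃ p ∈ M, ∀ w ∈ M, ⟪v - p, w⟫_A = 0}
  add_mem' := by
    rintro v v' ⟨p, hp, h⟩ ⟨p', hp', h'⟩
    refine ⟨p + p', M.add_mem hp hp', fun w hw => ?_⟩
    rw [add_sub_add_comm, CStarModule.inner_add_left, h w hw, h' w hw, add_zero]
  zero_mem' := ⟨0, M.zero_mem, fun w _ => by simp⟩
  smul_mem' := by
    rintro c v ⟨p, hp, h⟩
    refine ⟨c • p, M.smul_mem c hp, fun w hw => ?_⟩
    rw [← smul_sub, CStarModule.inner_smul_left_complex, h w hw, smul_zero]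

variable {A} {M : Submodule ℂ F}

/-- Cauchy–Schwarz applied to `⟪v, p⟫ = ⟪p, p⟫`. -/
theorem norm_le_of_sub_orthogonal {v p : F} (hp : p ∈ M) (h : ∀ w ∈ M, ⟪v - p, w⟫_A = 0) :
    ‖p‖ ≤ ‖v‖ := by
  rcases eq_or_ne p 0 with rfl | h0
  · simp
  have hpos : 0 < ‖p‖ := norm_pos_iff.2 h0
  have h1 : ⟪v, p⟫_A = ⟪p, p⟫_A := by
    rw [← sub_eq_zero, ← CStarModule.inner_sub_left, h p hp]
  refine le_of_mul_le_mul_right ?_ hpos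
  calc ‖p‖ * ‖p‖ = ‖⟪v, p⟫_A‖ := by rw [h1, ← CStarModule.norm_sq_eq A, pow_two]
    _ ≤ ‖v‖ * ‖p‖ := CStarModule.norm_inner_le F

theorem norm_sub_le_of_sub_orthogonal {v p v' p' : F} (hp : p ∈ M)
    (h : ∀ w ∈ M, ⟪v - p, w⟫_A = 0) (hp' : p' ∈ M) (h' : ∀ w ∈ M, ⟪v' - p', w⟫_A = 0) :
    ‖p - p'‖ ≤ ‖v - v'‖ := by
  refine norm_le_of_sub_orthogonal (A := A) (M.sub_mem hp hp') fun w hw => ?_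
  rw [sub_sub_sub_comm, CStarModule.inner_sub_left, h w hw, h' w hw, sub_zero]

/-- The component in `M` is a 1-Lipschitz function of the vector, so components of a convergent
sequence converge. Regularity gives only density of the sum; this upgrades it to the whole module.
-/
theorem isClosed_orthogonalSum [CompleteSpace F] (hM : IsClosed (M : Set F)) :
    IsClosed (orthogonalSum A M : Set F) := by
  refine IsSeqClosed.isClosed fun v v₀ hv hlim => ?_
  choose p hp h using hv
  have hc : CauchySeq p := by
    refine Metric.cauchySeq_iff'.2 fun ε hε => ?_
    obtain ⟨N, hN⟩ := Metric.cauchySeq_iff'.1 hlim.cauchySeq ε hε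
    refine ⟨N, fun n hn => ?_⟩
    have := hN n hn
    rw [dist_eq_norm] at this ⊢
    exact (norm_sub_le_of_sub_orthogonal (hp n) (h n) (hp N) (h N)).trans_lt this
  obtain ⟨p₀, hp₀⟩ := cauchySeq_tendsto_of_complete hc
  refine ⟨p₀, hM.mem_of_tendsto hp₀ (Filter.Eventually.of_forall hp), fun w hw => ?_⟩
  have hcont : Continuous fun x : F => ⟪x, w⟫_A :=
    CStarModule.continuous_inner.comp (continuous_id.prodMk continuous_const)
  have h1 := (hcont.tendsto (v₀ - p₀)).comp (hlim.sub hp₀)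
  refine tendsto_nhds_unique h1 ?_
  have h2 : (fun x : F => ⟪x, w⟫_A) ∘ (fun n => v n - p n) = fun _ => 0 :=
    funext fun n => h n w hw
  rw [h2]
  exact tendsto_const_nhds

theorem exists_projection (hM : orthogonalSum A M = ⊤) :
    ∃ P : F →L[ℂ] F, ∀ v, P v ∈ M ∧ ∀ w ∈ M, ⟪v - P v, w⟫_A = 0 := by
  have hv : ∀ v : F, v ∈ orthogonalSum A M := fun v => hM ▸ Submodule.mem_top
  choose p hp h using hv
  have huniq : ∀ v q, q ∈ M → (∀ w ∈ M, ⟪v - q, w⟫_A = 0) → p v = q := fun v q hq h' => by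
    have := norm_sub_le_of_sub_orthogonal (hp v) (h v) hq h'
    rw [sub_self, norm_zero] at this
    exact sub_eq_zero.1 (norm_le_zero_iff.1 this)
  let P : F →ₗ[ℂ] F :=
    { toFun := p
      map_add' := fun v v' => huniq _ _ (M.add_mem (hp v) (hp v')) fun w hw => by
        rw [add_sub_add_comm, CStarModule.inner_add_left, h v w hw, h v' w hw, add_zero]
      map_smul' := fun c v => huniq _ _ (M.smul_mem c (hp v)) fun w hw => by
        rw [RingHom.id_apply, ← smul_sub, CStarModule.inner_smul_left_complex, h v w hw,
          smul_zero] }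
  exact ⟨P.mkContinuous 1 fun v => by
    simpa [P] using norm_le_of_sub_orthogonal (hp v) (h v), fun v => ⟨hp v, h v⟩⟩

end Decomposition

/-! Graphs of unbounded operators. -/

section Graph

variable {E : Type*} [NormedAddCommGroup E] [NormedSpace ℂ E]

theorem mem_graph_ofBounded {T : E →L[ℂ] E} {x y : E} :
    (x, y) ∈ (ofBounded T).graph ↔ y = T x := by
  rw [LinearPMap.mem_graph_iff]
  constructor
  · rintro ⟨z, rfl, rfl⟩
    rfl
  · rintro rfl
    exact ⟨⟨x, trivial⟩, rfl, rfl⟩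

theorem eq_ofBounded {f : E →ₗ.[ℂ] E} {T : E →L[ℂ] E} (h : ∀ x, (x, T x) ∈ f.graph) :
    f = ofBounded T := by
  refine LinearPMap.eq_of_eq_graph (Submodule.ext ?_)
  rintro ⟨x, y⟩
  rw [mem_graph_ofBounded]
  exact ⟨fun hy => LinearPMap.mem_graph_snd_inj f hy (h x) rfl, fun hy => hy ▸ h x⟩

theorem isClosed_ofBounded (T : E →L[ℂ] E) : (ofBounded T).IsClosed := by
  have : ((ofBounded T).graph : Set (E × E)) = {p | p.2 = T p.1} :=
    Set.ext fun _ => mem_graph_ofBounded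
  rw [LinearPMap.IsClosed, this]
  exact isClosed_eq continuous_snd (T.continuous.comp continuous_fst)

/-- A densely defined restriction of a bounded operator is closable, and its closure is that
bounded operator. -/
theorem closure_eq_ofBounded {f : E →ₗ.[ℂ] E} {T : E →L[ℂ] E} (hd : Dense (f.domain : Set E))
    (h : ∀ x y, (x, y) ∈ f.graph → y = T x) :
    f.IsClosable ∧ f.closure = ofBounded T := by
  have hle : f ≤ ofBounded T := LinearPMap.le_of_le_graph fun p hp =>
    mem_graph_ofBounded.2 (h p.1 p.2 hp)
  have hf : f.IsClosable := (isClosed_ofBounded T).isClosable.leIsClosable hle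
  refine ⟨hf, eq_ofBounded fun x => ?_⟩
  rw [← hf.graph_closure_eq_closure_graph]
  refine map_mem_closure (f := fun x : E => (x, T x)) (by fun_prop) (hd x) fun z hz => ?_
  have hz' := f.mem_graph ⟨z, hz⟩
  have := h _ _ hz'
  rw [this] at hz'
  exact hz'

end Graph

/-! The graph of a regular operator is orthogonally complemented. -/

section Module

set_option linter.unusedSectionVars false

variable {A E : Type*} [NonUnitalCStarAlgebra A] [PartialOrder A] [StarOrderedRing A]
  [NormedAddCommGroup E] [NormedSpace ℂ E] [SMul A E] [CStarModule A E]

theorem mem_adjointGraph_iff {t : E →ₗ.[ℂ] E} {y z : E} :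
    (y, z) ∈ adjointGraph A t ↔ ∀ u v, (u, v) ∈ t.graph → ⟪v, y⟫_A = ⟪u, z⟫_A := by
  constructor
  · rintro h u v huv
    obtain ⟨x, rfl, rfl⟩ := (LinearPMap.mem_graph_iff t).1 huv
    exact h x
  · intro h x
    exact h _ _ (t.mem_graph x)

theorem mem_graph_oneAddAdjointMul {t : E →ₗ.[ℂ] E} {x z : E} :
    (x, z) ∈ (oneAddAdjointMul A t).graph ↔
      ∃ y w, (x, y) ∈ t.graph ∧ (y, w) ∈ (adjoint A t).graph ∧ z = x + w := by
  have key : (x, z) ∈ (oneAddAdjointMul A t).graph ↔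
      ∃ w, (x, w) ∈ (pcomp (adjoint A t) t).graph ∧ z = x + w := by
    simp only [LinearPMap.mem_graph_iff]
    constructor
    · rintro ⟨y, rfl, rfl⟩
      exact ⟨_, ⟨y, rfl, rfl⟩, rfl⟩
    · rintro ⟨w, ⟨y, rfl, rfl⟩, rfl⟩
      exact ⟨y, rfl, rfl⟩
  rw [key]
  simp only [mem_graph_pcomp]
  constructor
  · rintro ⟨w, ⟨y, h1, h2⟩, rfl⟩
    exact ⟨y, w, h1, h2, rfl⟩
  · rintro ⟨y, w, h1, h2, rfl⟩
    exact ⟨w, ⟨y, h1, h2⟩, rfl⟩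

theorem eq_zero_of_inner_self_add_eq_zero {x y : E} (h : ⟪x, x⟫_A + ⟪y, y⟫_A = 0) : x = 0 := by
  refine (CStarModule.inner_self (A := A)).1 (le_antisymm ?_ CStarModule.inner_self_nonneg)
  exact h ▸ le_add_of_nonneg_right CStarModule.inner_self_nonneg

/-- The orthogonal sum of the graph of a regular operator and its complement is everything. -/
theorem IsRegular.orthogonalSum_graph [CompleteSpace E] {t : E →ₗ.[ℂ] E} (ht : IsRegular A t) :
    orthogonalSum A (t.graph.comap
      (WithCStarModule.equivL ℂ : C⋆ᵐᵒᵈ(A, E × E) ≃L[ℂ] E × E).toLinearMap) = ⊤ := by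
  let e : C⋆ᵐᵒᵈ(A, E × E) ≃L[ℂ] E × E := WithCStarModule.equivL ℂ
  let M : Submodule ℂ C⋆ᵐᵒᵈ(A, E × E) := t.graph.comap e.toLinearMap
  have hM : IsClosed (M : Set C⋆ᵐᵒᵈ(A, E × E)) := ht.closed.preimage e.continuous
  have hS : IsClosed (orthogonalSum A M : Set C⋆ᵐᵒᵈ(A, E × E)) := isClosed_orthogonalSum hM
  have hsum : ∀ u v y z, (u, v) ∈ t.graph → (y, z) ∈ adjointGraph A t →
      e.symm (u + z, v - y) ∈ orthogonalSum A M := by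
    intro u v y z huv hyz
    refine ⟨e.symm (u, v), huv, fun w hw => ?_⟩
    have h1 := mem_adjointGraph_iff.1 hyz _ _ (show (w.1, w.2) ∈ t.graph from hw)
    rw [← map_sub, WithCStarModule.prod_inner]
    change ⟪u + z - u, w.1⟫_A + ⟪v - y - v, w.2⟫_A = 0
    rw [add_sub_cancel_left, sub_sub_cancel_left, CStarModule.inner_neg_left, inner_eq_swap h1,
      add_neg_cancel]
  -- Taking `v = y = t x` in `hsum` yields `((1 + t* t) x, 0)`, and these first coordinates are
  -- dense.
  have h1 : ∀ x : E, e.symm (x, 0) ∈ orthogonalSum A M := by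
    have hc : IsClosed {x : E | e.symm (x, 0) ∈ orthogonalSum A M} :=
      hS.preimage (e.symm.continuous.comp (by fun_prop : Continuous fun x : E => (x, (0 : E))))
    refine fun x => hc.closure_subset_iff.2 ?_ (ht.dense_range x)
    rintro _ ⟨x, rfl⟩
    obtain ⟨y, w, hy, hw, hz⟩ :=
      mem_graph_oneAddAdjointMul.1 ((oneAddAdjointMul A t).mem_graph x)
    rw [graph_adjoint A t ht.dense_domain] at hw
    have := hsum _ _ _ _ hy hw
    rw [← hz, sub_self] at this
    exact this
  -- For `y ∈ D(t*)`, a dense set, `(0, y) = (t* y, 0) - (t* y, -y)`.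
  have h2 : ∀ y : E, e.symm (0, y) ∈ orthogonalSum A M := by
    have hc : IsClosed {y : E | e.symm (0, y) ∈ orthogonalSum A M} :=
      hS.preimage (e.symm.continuous.comp (by fun_prop : Continuous fun y : E => ((0 : E), y)))
    refine fun y => hc.closure_subset_iff.2 ?_ (ht.dense_adjoint_domain y)
    intro y hy
    have hg := (adjoint A t).mem_graph ⟨y, hy⟩
    rw [graph_adjoint A t ht.dense_domain] at hg
    have h3 := hsum _ _ _ _ t.graph.zero_mem hg
    have h4 := Submodule.sub_mem _ (h1 (adjoint A t ⟨y, hy⟩)) h3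
    rw [← map_sub] at h4
    simpa using h4
  refine eq_top_iff.2 fun v _ => ?_
  have := Submodule.add_mem _ (h1 v.1) (h2 v.2)
  rw [← map_add] at this
  have hv : v = e.symm ((v.1, 0) + (0, v.2)) := by
    rw [Prod.mk_add_mk, add_zero, zero_add]
    rfl
  rw [hv]
  exact this

theorem IsRegular.isGraphProjection [CompleteSpace E] {t : E →ₗ.[ℂ] E} (ht : IsRegular A t) :
    IsGraphProjection A t (graphProjection A t) := by
  have h : ∃ P, IsGraphProjection A t P := exists_projection ht.orthogonalSum_graph
  rw [graphProjection, dif_pos h]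
  exact h.choose_spec

/-- The operators `a`, `b`, `c`, `d` are the entries of the orthogonal projection of `E ⊕ E` onto
the graph of `t`. -/
structure IsGraphMatrix (A : Type*) [NonUnitalCStarAlgebra A] [PartialOrder A]
    [StarOrderedRing A] [SMul A E] [CStarModule A E] (t : E →ₗ.[ℂ] E) (a b c d : E →L[ℂ] E) :
    Prop where
  fst_mem : ∀ x, (a x, c x) ∈ t.graph
  snd_mem : ∀ y, (b y, d y) ∈ t.graph
  fst_adjoint : ∀ x, (c x, x - a x) ∈ adjointGraph A t
  snd_adjoint : ∀ y, (y - d y, b y) ∈ adjointGraph A t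

/-! ### Entries of the graph projection and the Fredholm property -/

namespace IsGraphMatrix

variable {t : E →ₗ.[ℂ] E} {a b c d : E →L[ℂ] E}

/-- With the next two lemmas this is `P = P* P` and `P = P*` in entries; adjointability of all four
entries follows. -/
theorem inner_fst_fst (h : IsGraphMatrix A t a b c d) (x y : E) :
    ⟪a x, y⟫_A = ⟪a x, a y⟫_A + ⟪c x, c y⟫_A := by
  have := mem_adjointGraph_iff.1 (h.fst_adjoint y) _ _ (h.fst_mem x)
  rw [this, CStarModule.inner_sub_right, add_sub_cancel]

theorem inner_snd_snd (h : IsGraphMatrix A t a b c d) (x y : E) :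
    ⟪d x, y⟫_A = ⟪b x, b y⟫_A + ⟪d x, d y⟫_A := by
  have := mem_adjointGraph_iff.1 (h.snd_adjoint y) _ _ (h.snd_mem x)
  rw [← this, CStarModule.inner_sub_right, sub_add_cancel]

theorem inner_snd_fst (h : IsGraphMatrix A t a b c d) (x y : E) :
    ⟪c x, y⟫_A = ⟪x, b y⟫_A := by
  have h1 := mem_adjointGraph_iff.1 (h.snd_adjoint y) _ _ (h.fst_mem x)
  have h2 := inner_eq_swap (mem_adjointGraph_iff.1 (h.fst_adjoint x) _ _ (h.snd_mem y))
  rw [CStarModule.inner_sub_right, h2, CStarModule.inner_sub_left] at h1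
  rw [sub_eq_iff_eq_add.1 h1, add_sub_cancel]

theorem isAdjointable_a (h : IsGraphMatrix A t a b c d) : IsAdjointable A a :=
  ⟨a, fun x y => by
    rw [h.inner_fst_fst, ← CStarModule.star_inner (a y) x, h.inner_fst_fst y x, star_add,
      CStarModule.star_inner, CStarModule.star_inner]⟩

theorem isAdjointable_d (h : IsGraphMatrix A t a b c d) : IsAdjointable A d :=
  ⟨d, fun x y => by
    rw [h.inner_snd_snd, ← CStarModule.star_inner (d y) x, h.inner_snd_snd y x, star_add,
      CStarModule.star_inner, CStarModule.star_inner]⟩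

theorem isAdjointable_c (h : IsGraphMatrix A t a b c d) : IsAdjointable A c :=
  ⟨b, h.inner_snd_fst⟩

theorem isAdjointable_b (h : IsGraphMatrix A t a b c d) : IsAdjointable A b :=
  ⟨c, fun x y => inner_eq_swap (h.inner_snd_fst y x).symm⟩

/-- The projection fixes its range: the difference of the two sides lies in the graph and is
orthogonal to it. -/
theorem apply_graph (h : IsGraphMatrix A t a b c d) {x z : E} (hxz : (x, z) ∈ t.graph) :
    x = a x + b z ∧ z = c x + d z := by
  have h1 : (x - (a x + b z), z - (c x + d z)) ∈ t.graph :=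
    t.graph.sub_mem hxz (t.graph.add_mem (h.fst_mem x) (h.snd_mem z))
  have h2 : (c x - (z - d z), x - a x - b z) ∈ adjointGraph A t :=
    (adjointGraph A t).sub_mem (h.fst_adjoint x) (h.snd_adjoint z)
  have h3 := mem_adjointGraph_iff.1 h2 _ _ h1
  have e1 : c x - (z - d z) = -(z - (c x + d z)) := by abel
  have e2 : x - a x - b z = x - (a x + b z) := by abel
  rw [e1, e2, CStarModule.inner_neg_right] at h3
  have h4 : ⟪x - (a x + b z), x - (a x + b z)⟫_A +
      ⟪z - (c x + d z), z - (c x + d z)⟫_A = 0 := by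
    rw [← h3, neg_add_cancel]
  exact ⟨sub_eq_zero.1 (eq_zero_of_inner_self_add_eq_zero h4),
    sub_eq_zero.1 (eq_zero_of_inner_self_add_eq_zero ((add_comm _ _).trans h4))⟩

/-- A left inverse of `t` modulo `K(E)`, in terms of the entries of the graph projection. -/
theorem exists_isPseudoLeftInverse_iff (h : IsGraphMatrix A t a b c d)
    (hd : Dense (t.domain : Set E)) :
    (∃ G, IsPseudoLeftInverse A G t) ↔ ∃ V W : E →L[ℂ] E, IsAdjointable A V ∧
      IsAdjointable A W ∧ V * (1 - a) + W * c - 1 ∈ compacts A E := by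
  constructor
  · rintro ⟨G, hG, -, T, hT, hcl, hK⟩
    refine ⟨T, G, hT, hG, ?_⟩
    have hGT : ∀ x z, (x, z) ∈ t.graph → G z = T x := fun x z hxz => by
      have h1 : (x, G z) ∈ (pcomp (ofBounded G) t).graph :=
        (mem_graph_pcomp _ _ _ _).2 ⟨z, hxz, mem_graph_ofBounded.2 rfl⟩
      have h2 := LinearPMap.le_graph_of_le (LinearPMap.le_closure _) h1
      rw [hcl] at h2
      exact mem_graph_ofBounded.1 h2
    -- Since `c = t a`, one has `G c = T a`.
    have e : T * (1 - a) + G * c = T := by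
      ext x
      simp [hGT _ _ (h.fst_mem x)]
    rw [e]
    exact hK
  · rintro ⟨V, W, hV, hW, hK⟩
    -- On `D(t)`, `1 - a = b t` and `c = (1 - d) t`; hence `V(1 - a) + Wc` extends `(Vb + W(1 - d))
    -- t`.
    have hG : IsAdjointable A (V * b + W * (1 - d)) :=
      (hV.mul h.isAdjointable_b).add (hW.mul (isAdjointable_one.sub h.isAdjointable_d))
    have hT : IsAdjointable A (V * (1 - a) + W * c) :=
      (hV.mul (isAdjointable_one.sub h.isAdjointable_a)).add (hW.mul h.isAdjointable_c)
    obtain ⟨h1, h2⟩ := closure_eq_ofBounded (f := pcomp (ofBounded (V * b + W * (1 - d))) t)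
      (T := V * (1 - a) + W * c) (hd.mono fun x hx => by
        have h3 : (x, (V * b + W * (1 - d)) (t ⟨x, hx⟩)) ∈
            (pcomp (ofBounded (V * b + W * (1 - d))) t).graph :=
          (mem_graph_pcomp _ _ _ _).2 ⟨_, t.mem_graph ⟨x, hx⟩, mem_graph_ofBounded.2 rfl⟩
        exact LinearPMap.mem_domain_of_mem_graph h3) (fun x y hxy => by
        obtain ⟨z, hz, hy⟩ := (mem_graph_pcomp _ _ _ _).1 hxy
        obtain ⟨hx1, hx2⟩ := h.apply_graph hz
        have e1 : b z = x - a x := eq_sub_of_add_eq' hx1.symm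
        have e2 : z - d z = c x := sub_eq_of_eq_add hx2
        rw [mem_graph_ofBounded.1 hy]
        simp only [add_apply, mul_apply_eq_comp, sub_apply, one_apply_eq_self, e1, e2])
    exact ⟨_, hG, h1, _, hT, h2, hK⟩

/-- A right inverse of `t` modulo `K(E)`, in terms of the entries of the graph projection. -/
theorem exists_isPseudoRightInverse_iff (h : IsGraphMatrix A t a b c d) (hc : t.IsClosed) :
    (∃ H, IsPseudoRightInverse A H t) ↔ ∃ V W : E →L[ℂ] E, IsAdjointable A V ∧
      IsAdjointable A W ∧ c * V + d * W - 1 ∈ compacts A E := by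
  constructor
  · rintro ⟨H, hH, hcb, T, hT, hcl, hK⟩
    refine ⟨H, T, hH, hT, ?_⟩
    -- Closedness of `t` carries the relation from the graph of `tH` to its closure.
    have hHT : ∀ x, (H x, T x) ∈ t.graph := fun x => by
      have h1 : (x, T x) ∈ (pcomp t (ofBounded H)).closure.graph :=
        hcl ▸ mem_graph_ofBounded.2 rfl
      rw [← hcb.graph_closure_eq_closure_graph] at h1
      have h2 : IsClosed {p : E × E | (H p.1, p.2) ∈ t.graph} :=
        hc.preimage (by fun_prop : Continuous fun p : E × E => (H p.1, p.2))
      refine h2.closure_subset_iff.2 ?_ h1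
      rintro ⟨u, v⟩ huv
      obtain ⟨y, hy, hyv⟩ := (mem_graph_pcomp _ _ _ _).1 huv
      rw [mem_graph_ofBounded.1 hy] at hyv
      exact hyv
    have e : c * H + d * T = T := by
      ext x
      exact (h.apply_graph (hHT x)).2.symm
    rw [e]
    exact hK
  · rintro ⟨V, W, hV, hW, hK⟩
    have hT : IsAdjointable A (c * V + d * W) :=
      (h.isAdjointable_c.mul hV).add (h.isAdjointable_d.mul hW)
    -- The projection sends `(V x, W x)` into the graph, so `t(aV + bW)` is everywhere defined and
    -- already bounded.
    have e : pcomp t (ofBounded (a * V + b * W)) = ofBounded (c * V + d * W) :=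
      eq_ofBounded fun x => (mem_graph_pcomp _ _ _ _).2 ⟨_, mem_graph_ofBounded.2 rfl,
        t.graph.add_mem (h.fst_mem (V x)) (h.snd_mem (W x))⟩
    have h1 := closure_eq_ofBounded (f := ofBounded (c * V + d * W)) (T := c * V + d * W)
      dense_univ fun x y => mem_graph_ofBounded.1
    refine ⟨_, (h.isAdjointable_a.mul hV).add (h.isAdjointable_b.mul hW), ?_⟩
    rw [e]
    exact ⟨h1.1, _, hT, h1.2, hK⟩

end IsGraphMatrix

/-! ### The resolvents in `graphDist` as matrix entries -/

theorem resolventSq_eq {t : E →ₗ.[ℂ] E} {B : E →L[ℂ] E} (hd : Dense (t.domain : Set E))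
    (h : ∀ x, (B x, x) ∈ (oneAddAdjointMul A t).graph) : resolventSq A t = B := by
  -- Injectivity comes from `⟪x, (1 + t* t) x⟫ = ⟪x, x⟫ + ⟪t x, t x⟫`.
  have hker : LinearMap.ker (oneAddAdjointMul A t).toFun = ⊥ := by
    refine LinearMap.ker_eq_bot'.2 fun x hx => Subtype.ext ?_
    have hg := (oneAddAdjointMul A t).mem_graph x
    rw [show (oneAddAdjointMul A t) x = 0 from hx] at hg
    obtain ⟨y, w, hy, hw, h0⟩ := mem_graph_oneAddAdjointMul.1 hg
    rw [graph_adjoint A t hd] at hw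
    refine eq_zero_of_inner_self_add_eq_zero (A := A) (y := y) ?_
    rw [mem_adjointGraph_iff.1 hw _ _ hy, ← CStarModule.inner_add_right, ← h0,
      CStarModule.inner_zero_right]
  have e : (oneAddAdjointMul A t).inverse = ofBounded B := eq_ofBounded fun x => by
    rw [LinearPMap.inverse_graph hker]
    exact ⟨_, h x, rfl⟩
  rw [resolventSq, e, toBounded_ofBounded]

namespace IsGraphMatrix

variable {t : E →ₗ.[ℂ] E} {a b c d : E →L[ℂ] E}

theorem resolventSq_eq (h : IsGraphMatrix A t a b c d) (hd : Dense (t.domain : Set E)) :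
    resolventSq A t = a :=
  HilbertModule.resolventSq_eq hd fun x => mem_graph_oneAddAdjointMul.2
    ⟨c x, x - a x, h.fst_mem x, graph_adjoint A t hd ▸ h.fst_adjoint x, by abel⟩

theorem mulResolventSq_eq (h : IsGraphMatrix A t a b c d) (hd : Dense (t.domain : Set E)) :
    mulResolventSq A t = c := by
  have e : pcomp t (ofBounded a) = ofBounded c := eq_ofBounded fun x =>
    (mem_graph_pcomp _ _ _ _).2 ⟨_, mem_graph_ofBounded.2 rfl, h.fst_mem x⟩
  rw [mulResolventSq, h.resolventSq_eq hd, e, toBounded_ofBounded]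

theorem resolventSq_adjoint_eq (h : IsGraphMatrix A t a b c d) (hd : Dense (t.domain : Set E))
    (hd' : Dense ((adjoint A t).domain : Set E)) : resolventSq A (adjoint A t) = 1 - d := by
  refine HilbertModule.resolventSq_eq hd' fun y => mem_graph_oneAddAdjointMul.2
    ⟨b y, d y, graph_adjoint A t hd ▸ h.snd_adjoint y, ?_, (sub_add_cancel y (d y)).symm⟩
  -- Only the inclusion `t ⊆ t**` is needed here.
  rw [graph_adjoint A _ hd', mem_adjointGraph_iff]
  intro u v huv
  rw [graph_adjoint A t hd] at huv
  exact (inner_eq_swap (mem_adjointGraph_iff.1 huv _ _ (h.snd_mem y))).symm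

/-- Operators whose graph projections have entries close to those of a Fredholm operator are
Fredholm. -/
theorem exists_isFredholm_of_norm_sub_le [CompleteSpace E] (h : IsGraphMatrix A t a b c d)
    (ht : IsRegular A t) (hF : IsFredholm A t) :
    ∃ r : ℝ, 0 < r ∧ ∀ (s : E →ₗ.[ℂ] E) (a' b' c' d' : E →L[ℂ] E), IsRegular A s →
      IsGraphMatrix A s a' b' c' d' → ‖a' - a‖ ≤ r → ‖c' - c‖ ≤ r → ‖d' - d‖ ≤ r →
      IsFredholm A s := by
  obtain ⟨V, W, hV, hW, hVW⟩ := (h.exists_isPseudoLeftInverse_iff ht.dense_domain).1 hF.1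
  obtain ⟨X, Y, hX, hY, hXY⟩ := (h.exists_isPseudoRightInverse_iff ht.closed).1 hF.2
  -- The summand `1` keeps `N` positive and makes the estimates strict.
  let N := ‖V‖ + ‖W‖ + ‖X‖ + ‖Y‖ + 1
  have hN : 0 < N := by positivity
  refine ⟨1 / N, by positivity, fun s a' b' c' d' hs h' ha hc hd => ?_⟩
  have hlt : ∀ p q : ℝ, p + q < N → p * (1 / N) + q * (1 / N) < 1 := fun p q hpq => by
    rwa [← add_mul, mul_one_div, div_lt_one hN]
  have h1 : ‖(V * (1 - a') + W * c') - (V * (1 - a) + W * c)‖ < 1 := by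
    have e : (V * (1 - a') + W * c') - (V * (1 - a) + W * c) =
        W * (c' - c) - V * (a' - a) := by noncomm_ring
    rw [e]
    calc ‖W * (c' - c) - V * (a' - a)‖ ≤ ‖W * (c' - c)‖ + ‖V * (a' - a)‖ := norm_sub_le _ _
      _ ≤ ‖W‖ * ‖c' - c‖ + ‖V‖ * ‖a' - a‖ := add_le_add (norm_mul_le _ _) (norm_mul_le _ _)
      _ ≤ ‖W‖ * (1 / N) + ‖V‖ * (1 / N) := by gcongr
      _ < 1 := hlt _ _ (by
        simp only [N]
        linarith [norm_nonneg X, norm_nonneg Y])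
  have h2 : ‖(c' * X + d' * Y) - (c * X + d * Y)‖ < 1 := by
    have e : (c' * X + d' * Y) - (c * X + d * Y) = (c' - c) * X + (d' - d) * Y := by
      noncomm_ring
    rw [e]
    calc ‖(c' - c) * X + (d' - d) * Y‖ ≤ ‖(c' - c) * X‖ + ‖(d' - d) * Y‖ := norm_add_le _ _
      _ ≤ ‖c' - c‖ * ‖X‖ + ‖d' - d‖ * ‖Y‖ := add_le_add (norm_mul_le _ _) (norm_mul_le _ _)
      _ ≤ (1 / N) * ‖X‖ + (1 / N) * ‖Y‖ := by gcongr
      _ < 1 := by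
        rw [mul_comm (1 / N) ‖X‖, mul_comm (1 / N) ‖Y‖]
        refine hlt _ _ ?_
        simp only [N]
        linarith [norm_nonneg V, norm_nonneg W]
  constructor
  · obtain ⟨U, hU, -, hUK⟩ := exists_inverse_mod_compacts
      ((hV.mul (isAdjointable_one.sub h.isAdjointable_a)).add (hW.mul h.isAdjointable_c))
      ((hV.mul (isAdjointable_one.sub h'.isAdjointable_a)).add (hW.mul h'.isAdjointable_c))
      hVW h1
    refine (h'.exists_isPseudoLeftInverse_iff hs.dense_domain).2
      ⟨U * V, U * W, hU.mul hV, hU.mul hW, ?_⟩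
    rwa [mul_assoc, mul_assoc, ← mul_add]
  · obtain ⟨U, hU, hUK, -⟩ := exists_inverse_mod_compacts
      ((h.isAdjointable_c.mul hX).add (h.isAdjointable_d.mul hY))
      ((h'.isAdjointable_c.mul hX).add (h'.isAdjointable_d.mul hY)) hXY h2
    refine (h'.exists_isPseudoRightInverse_iff hs.closed).2
      ⟨X * U, Y * U, hX.mul hU, hY.mul hU, ?_⟩
    rwa [← mul_assoc, ← mul_assoc, ← add_mul]

end IsGraphMatrix

/-- The entry `p P i` of an operator `P` on `E ⊕ E`. -/
def entry (p : E × E →L[ℂ] E) (i : E →L[ℂ] E × E)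
    (P : C⋆ᵐᵒᵈ(A, E × E) →L[ℂ] C⋆ᵐᵒᵈ(A, E × E)) : E →L[ℂ] E :=
  p ∘L (WithCStarModule.equivL ℂ : C⋆ᵐᵒᵈ(A, E × E) ≃L[ℂ] E × E).toContinuousLinearMap ∘L P ∘L
    (WithCStarModule.equivL ℂ : C⋆ᵐᵒᵈ(A, E × E) ≃L[ℂ] E × E).symm.toContinuousLinearMap ∘L i

/-- The Hilbert module norm on `E ⊕ E` lies between the maximum and the sum of the coordinate norms,
hence the different conditions on `p` and `i`. -/
theorem norm_entry_sub_le {p : E × E →L[ℂ] E} {i : E →L[ℂ] E × E} (hp : ∀ v, ‖p v‖ ≤ ‖v‖)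
    (hi : ∀ x, ‖(i x).1‖ + ‖(i x).2‖ ≤ ‖x‖)
    (P Q : C⋆ᵐᵒᵈ(A, E × E) →L[ℂ] C⋆ᵐᵒᵈ(A, E × E)) :
    ‖entry p i P - entry p i Q‖ ≤ ‖P - Q‖ := by
  refine ContinuousLinearMap.opNorm_le_bound _ (P - Q).opNorm_nonneg fun x => ?_
  let e : C⋆ᵐᵒᵈ(A, E × E) ≃L[ℂ] E × E := WithCStarModule.equivL ℂ
  have h1 : (entry p i P - entry p i Q) x = p (e ((P - Q) (e.symm (i x)))) := by
    simp [entry, e]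
  rw [h1]
  calc ‖p (e ((P - Q) (e.symm (i x))))‖ ≤ ‖e ((P - Q) (e.symm (i x)))‖ := hp _
    _ ≤ ‖(P - Q) (e.symm (i x))‖ := WithCStarModule.norm_equiv_le_norm_prod _
    _ ≤ ‖P - Q‖ * ‖e.symm (i x)‖ := (P - Q).le_opNorm _
    _ ≤ ‖P - Q‖ * ‖x‖ := by
      gcongr
      exact (WithCStarModule.prod_norm_le_norm_add _).trans (hi x)

theorem IsGraphProjection.isGraphMatrix {t : E →ₗ.[ℂ] E}
    {P : C⋆ᵐᵒᵈ(A, E × E) →L[ℂ] C⋆ᵐᵒᵈ(A, E × E)} (h : IsGraphProjection A t P) :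
    IsGraphMatrix A t (entry (.fst ℂ E E) (.inl ℂ E E) P) (entry (.fst ℂ E E) (.inr ℂ E E) P)
      (entry (.snd ℂ E E) (.inl ℂ E E) P) (entry (.snd ℂ E E) (.inr ℂ E E) P) := by
  let e : C⋆ᵐᵒᵈ(A, E × E) ≃L[ℂ] E × E := WithCStarModule.equivL ℂ
  have key : ∀ x y u v, (u, v) ∈ t.graph →
      ⟪x - (P (e.symm (x, y))).1, u⟫_A + ⟪y - (P (e.symm (x, y))).2, v⟫_A = 0 :=
    fun x y u v huv => (h (e.symm (x, y))).2 (e.symm (u, v)) huv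
  refine ⟨fun x => (h (e.symm (x, 0))).1, fun y => (h (e.symm (0, y))).1, fun x => ?_,
    fun y => ?_⟩
  · refine mem_adjointGraph_iff.2 fun u v huv => inner_eq_swap ?_
    have := key x 0 u v huv
    rw [zero_sub, CStarModule.inner_neg_left] at this
    exact (add_neg_eq_zero.1 this).symm
  · refine mem_adjointGraph_iff.2 fun u v huv => inner_eq_swap ?_
    have := key 0 y u v huv
    rw [zero_sub, CStarModule.inner_neg_left] at this
    exact (neg_add_eq_zero.1 this).symm

theorem graphDist_eq {t s : E →ₗ.[ℂ] E} {a b c d a' b' c' d' : E →L[ℂ] E}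
    (ht : IsRegular A t) (hs : IsRegular A s) (h : IsGraphMatrix A t a b c d)
    (h' : IsGraphMatrix A s a' b' c' d') :
    graphDist A s t = max ‖a' - a‖ (max ‖d' - d‖ ‖c' - c‖) := by
  rw [graphDist, h.resolventSq_eq ht.dense_domain, h'.resolventSq_eq hs.dense_domain,
    h.mulResolventSq_eq ht.dense_domain, h'.mulResolventSq_eq hs.dense_domain,
    h.resolventSq_adjoint_eq ht.dense_domain ht.dense_adjoint_domain,
    h'.resolventSq_adjoint_eq hs.dense_domain hs.dense_adjoint_domain, sub_sub_sub_cancel_left,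
    norm_sub_rev d d']

end Module

end HilbertModule

end

theorem mainTheorem1 {A E : Type*} [NonUnitalCStarAlgebra A] [PartialOrder A] [StarOrderedRing A]
    [NormedAddCommGroup E] [NormedSpace ℂ E] [SMul A E] [CStarModule A E] [CompleteSpace E] :
    (∀ t : E →ₗ.[ℂ] E, HilbertModule.IsRegular A t → HilbertModule.IsFredholm A t →
      ∃ r : ℝ, 0 < r ∧ ∀ s : E →ₗ.[ℂ] E, HilbertModule.IsRegular A s →
        HilbertModule.graphDist A s t ≤ r → HilbertModule.IsFredholm A s) ∧
    IsOpen {t : HilbertModule.RegularOperator A E | HilbertModule.IsFredholm A t.op} := by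
  constructor
  · intro t ht hF
    have h := ht.isGraphProjection.isGraphMatrix
    obtain ⟨r, hr, H⟩ := h.exists_isFredholm_of_norm_sub_le ht hF
    refine ⟨r, hr, fun s hs hd => ?_⟩
    have h' := hs.isGraphProjection.isGraphMatrix
    rw [HilbertModule.graphDist_eq ht hs h h', max_le_iff, max_le_iff] at hd
    exact H s _ _ _ _ hs h' hd.1 hd.2.2 hd.2.1
  · refine Metric.isOpen_iff.2 fun t hF => ?_
    have h := t.regular.isGraphProjection.isGraphMatrix
    obtain ⟨r, hr, H⟩ := h.exists_isFredholm_of_norm_sub_le t.regular hF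
    refine ⟨r, hr, fun s hs => ?_⟩
    have hd := (Metric.mem_ball.1 hs).le
    rw [HilbertModule.dist_eq] at hd
    refine H s.op _ _ _ _ s.regular s.regular.isGraphProjection.isGraphMatrix ?_ ?_ ?_ <;>
      refine (HilbertModule.norm_entry_sub_le ?_ ?_ _ _).trans hd
    all_goals first
      | exact fun v => norm_fst_le v
      | exact fun v => norm_snd_le v
      | exact fun x => by simp
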